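/- Let $\mathbb{K}=\mathbb{R}$ or $\mathbb{C}$ and let $\Gamma=(X,E)$ be a connected graph of bounded valency; the edge set $E\subset X\times X$ is symmetric. For $g:X\to\mathbb{K}$ put $\nabla g(x,y)=g(y)-g(x)$ for $(x,y)\in E$. For $1\le p<\infty$ let $D^p(\Gamma)=\{g:X\to\mathbb{K} : \nabla g\in\ell^p(E)\}$, and define the $\ell^p$-cohomology and the reduced $\ell^p$-cohomology in degree one by $$\ell^pH^1(\Gamma)=\big(\ell^p(E)\cap\nabla\mathbb{K}^X\big)/\nabla\ell^p(X),\qquad \overline{\ell^pH}^1(\Gamma)=\big(\ell^p(E)\cap\nabla\mathbb{K}^X\big)/\overline{\nabla\ell^p(X)}^{\,\ell^p(E)}.$$ A function $g\in D^p(\Gamma)$ represents the class of $\nabla g$ in $\ell^pH^1(\Gamma)$, and a class is identified with the set of the functions in $D^p(\Gamma)$ that represent it. Suppose that $\Gamma$ satisfies a strong isoperimetric inequality with isoperimetric constant $\kappa>0$: for every non-empty finite set $A\subset X$, $\kappa|A|\le|\partial A|$, where $\partial A$ is the set of edges between $A$ and its complement. Then: 1. For every $1\le p<\infty$ the cohomology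 is reduced, i.e. the natural quotient map $\ell^pH^1(\Gamma)\to\overline{\ell^pH}^1(\Gamma)$ is injective. 2. Let $n=\lceil\kappa^{-1}\rceil$ and let $\Gamma^{[n]}$ be the $n$-fuzz of $\Gamma$: the graph on $X$ in which two distinct vertices are adjacent if and only if their distance in $\Gamma$ is at most $n$. Then $\Gamma^{[n]}$ has a spanning tree $T$ such that, for every $1\le p<\infty$, the non-trivial classes of $\ell^pH^1(\Gamma)$, and likewise those of $\ell^pH^1(\Gamma^{[n]})$, are exactly the non-trivial classes of $\ell^pH^1(T)$ that are contained in $D^p(\Gamma^{[n]})$. -/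

import Mathlib

open scoped ENNReal

/-- Bounded valency: the numbers of neighbours of the vertices are bounded by one natural number. -/
def BoundedValency {V : Type*} (Γ : SimpleGraph V) : Prop :=
  ∃ D : ℕ, ∀ x : V, (Γ.neighborSet x).encard ≤ D

/-- The edge boundary of `A`: the edges between `A` and its complement, each listed once,
with its end in `A` first. -/
def edgeBoundary {V : Type*} (Γ : SimpleGraph V) (A : Set V) : Set (V × V) :=
  {e | e.1 ∈ A ∧ e.2 ∉ A ∧ Γ.Adj e.1 e.2}

/-- The strong isoperimetric inequality with isoperimetric constant `κ`:
`κ |A| ≤ |∂A|` for all non-empty finite sets of vertices `A`.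
(Used for graphs of bounded valency, where the edge boundary of a finite set is finite.) -/
def StrongIsoperimetric {V : Type*} (Γ : SimpleGraph V) (κ : ℝ) : Prop :=
  0 < κ ∧ ∀ A : Finset V, A.Nonempty →
    κ * (A.card : ℝ) ≤ ((edgeBoundary Γ (A : Set V)).ncard : ℝ)

/-- The `n`-fuzz: two distinct vertices are adjacent when their distance in `Γ` is at most `n`. -/
def fuzz {V : Type*} (Γ : SimpleGraph V) (n : ℕ) : SimpleGraph V where
  Adj x y := x ≠ y ∧ Γ.edist x y ≤ (n : ℕ∞)
  symm := ⟨fun x y h => ⟨h.1.symm, by rw [SimpleGraph.edist_comm]; exact h.2⟩⟩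
  loopless := ⟨fun _ h => h.1 rfl⟩

/-- The gradient `∇g(x,y) = g(y) - g(x)`, a function on the oriented edges. -/
def grad {V : Type*} (𝕜 : Type*) [RCLike 𝕜] (Γ : SimpleGraph V) :
    (V → 𝕜) →ₗ[𝕜] (Γ.Dart → 𝕜) where
  toFun g d := g d.snd - g d.fst
  map_add' g h := by
    funext d
    simp only [Pi.add_apply]
    ring
  map_smul' c g := by
    funext d
    simp only [Pi.smul_apply, smul_eq_mul, RingHom.id_apply]
    ring

/-- The space `D^p(Γ)` of `p`-Dirichlet functions: functions with gradient in `ℓ^p`. -/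
def Dirichlet {V : Type*} (𝕜 : Type*) [RCLike 𝕜] (Γ : SimpleGraph V) (p : ℝ≥0∞) :
    Submodule 𝕜 (V → 𝕜) where
  carrier := {g | Memℓp (grad 𝕜 Γ g) p}
  zero_mem' := by
    simp only [Set.mem_ofPred_eq, map_zero]
    exact zero_memℓp
  add_mem' hg hh := by
    simp only [Set.mem_ofPred_eq, map_add] at *
    exact hg.add hh
  smul_mem' c g hg := by
    simp only [Set.mem_ofPred_eq, map_smul] at *
    exact hg.const_smul c

/-- `ℓ^p(E) ∩ ∇ 𝕜^V`, the `p`-summable gradients. -/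
def lpGradients {V : Type*} (𝕜 : Type*) [RCLike 𝕜] (Γ : SimpleGraph V) (p : ℝ≥0∞) :
    Submodule 𝕜 (lp (fun _ : Γ.Dart => 𝕜) p) where
  carrier := {f | ∃ g : V → 𝕜, grad 𝕜 Γ g = f}
  zero_mem' := ⟨0, by rw [map_zero]; rfl⟩
  add_mem' := by
    rintro f₁ f₂ ⟨g₁, h₁⟩ ⟨g₂, h₂⟩
    exact ⟨g₁ + g₂, by rw [map_add, h₁, h₂]; rfl⟩
  smul_mem' := by
    rintro c f ⟨g, h⟩
    exact ⟨c • g, by rw [map_smul, h]; rfl⟩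

/-- `∇ ℓ^p(V)`, the gradients of the `p`-summable functions on the vertices. -/
def gradientsOfLp {V : Type*} (𝕜 : Type*) [RCLike 𝕜] (Γ : SimpleGraph V) (p : ℝ≥0∞) :
    Submodule 𝕜 (lp (fun _ : Γ.Dart => 𝕜) p) where
  carrier := {f | ∃ g : V → 𝕜, Memℓp g p ∧ grad 𝕜 Γ g = f}
  zero_mem' := ⟨0, zero_memℓp, by rw [map_zero]; rfl⟩
  add_mem' := by
    rintro f₁ f₂ ⟨g₁, m₁, h₁⟩ ⟨g₂, m₂, h₂⟩
    exact ⟨g₁ + g₂, m₁.add m₂, by rw [map_add, h₁, h₂]; rfl⟩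
  smul_mem' := by
    rintro c f ⟨g, m, h⟩
    exact ⟨c • g, m.const_smul c, by rw [map_smul, h]; rfl⟩

/-- The `ℓ^p`-cohomology in degree one, `(ℓ^p(E) ∩ ∇ 𝕜^V) / ∇ ℓ^p(V)`. -/
noncomputable abbrev LpH1 {V : Type*} (𝕜 : Type*) [RCLike 𝕜] (Γ : SimpleGraph V) (p : ℝ≥0∞) : Type _ :=
  lpGradients 𝕜 Γ p ⧸ (gradientsOfLp 𝕜 Γ p).submoduleOf (lpGradients 𝕜 Γ p)

/-- The reduced `ℓ^p`-cohomology in degree one: the quotient of `ℓ^p(E) ∩ ∇ 𝕜^V` by the closure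
of `∇ ℓ^p(V)` for the norm of `ℓ^p`. -/
noncomputable abbrev ReducedLpH1 {V : Type*} (𝕜 : Type*) [RCLike 𝕜] (Γ : SimpleGraph V) (p : ℝ≥0∞)
    [Fact (1 ≤ p)] : Type _ :=
  lpGradients 𝕜 Γ p ⧸
    (gradientsOfLp 𝕜 Γ p).topologicalClosure.submoduleOf (lpGradients 𝕜 Γ p)

/-- The natural quotient map from `ℓ^p`-cohomology to reduced `ℓ^p`-cohomology. -/
noncomputable def toReducedLpH1 {V : Type*} (𝕜 : Type*) [RCLike 𝕜] (Γ : SimpleGraph V) (p : ℝ≥0∞)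
    [Fact (1 ≤ p)] : LpH1 𝕜 Γ p →ₗ[𝕜] ReducedLpH1 𝕜 Γ p :=
  Submodule.factor (Submodule.comap_mono (Submodule.le_topologicalClosure _))

/-- The class `[∇g]` in `ℓ^p`-cohomology of a function `g ∈ D^p(Γ)`. -/
noncomputable def lpClass {V : Type*} (𝕜 : Type*) [RCLike 𝕜] (Γ : SimpleGraph V) (p : ℝ≥0∞)
    (g : Dirichlet 𝕜 Γ p) : LpH1 𝕜 Γ p :=
  Submodule.Quotient.mk ⟨⟨grad 𝕜 Γ g.1, g.2⟩, g.1, rfl⟩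

/-- The non-trivial cohomology classes of `Γ`, each regarded as the set of the functions
in `D^p(Γ)` that represent it. -/
def nontrivialClasses {V : Type*} (𝕜 : Type*) [RCLike 𝕜] (Γ : SimpleGraph V) (p : ℝ≥0∞) :
    Set (Set (V → 𝕜)) :=
  {C | ∃ c : LpH1 𝕜 Γ p, c ≠ 0 ∧
    C = {g | ∃ hg : g ∈ Dirichlet 𝕜 Γ p, lpClass 𝕜 Γ p ⟨g, hg⟩ = c}}

/-!
The cohomology is reduced because the gradient `ℓ^p(V) → ℓ^p(E)` is bounded below, so that its
range is closed. The lower bound is a Sobolev inequality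
(`StrongIsoperimetric.exists_tsum_le_tsum_grad`): the isoperimetric inequality for the level sets
of a non-negative summable function `f` gives the co-area inequality
`κ ∑ f ≤ ∑ (f(x) - f(y))⁺`, with the sum on the right over oriented edges
(`StrongIsoperimetric.mul_tsum_le_tsum`). For `f = ‖g‖ ^ p` the increments on the right are
at most `δ ‖g(y)‖ ^ p + C_δ ‖∇g(x, y)‖ ^ p`. Since the valency is bounded, the first terms sum up
to at most half of the left-hand side when `δ` is small.

For the description by a spanning tree, let `G` be connected of bounded valency. Functions with the
same gradient differ by a constant, so the class of `g` is the coset `g + (ℓ^p(V) + 𝕜)`, and the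
coset is non-trivial when `g` is not in `ℓ^p(V) + 𝕜` (`mem_nontrivialClasses_iff`). Hence `G` enters
only through `D^p(G)`, which contains `ℓ^p(V) + 𝕜`. Two consequences follow.

* If `H` is a connected spanning subgraph of `G`, then `D^p(G) ⊆ D^p(H)`, and the classes of `G`
  are those of `H` that are contained in `D^p(G)` (`nontrivialClasses_eq_of_le`). This applies to
  every spanning tree of the fuzz.
* A graph and its `n`-fuzz with `n ≥ 1` have the same Dirichlet functions
  (`dirichlet_le_dirichlet_fuzz`), hence the same classes (`nontrivialClasses_fuzz`).
-/

/-! ### Summation along maps with bounded fibres -/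

theorem sum_comp_le_of_encard_fiber_le {α β : Type*} {φ : β → α} {N : ℕ}
    (hφ : ∀ a, {b | φ b = a}.encard ≤ N) {F : α → ℝ} (hF : ∀ a, 0 ≤ F a) (hs : Summable F)
    (t : Finset β) : ∑ b ∈ t, F (φ b) ≤ N * ∑' a, F a := by
  classical
  rw [Finset.sum_comp F φ]
  calc ∑ a ∈ t.image φ, (t.filter fun b => φ b = a).card • F a
      ≤ ∑ a ∈ t.image φ, N * F a := by
        refine Finset.sum_le_sum fun a _ => ?_
        rw [nsmul_eq_mul]
        refine mul_le_mul_of_nonneg_right ?_ (hF a)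
        have h : ((t.filter fun b => φ b = a : Finset β) : Set β).encard ≤ N :=
          (Set.encard_le_encard fun b hb => (Finset.mem_filter.1 hb).2).trans (hφ a)
        rw [Set.encard_coe_eq_coe_finsetCard] at h
        exact_mod_cast h
    _ = N * ∑ a ∈ t.image φ, F a := by rw [Finset.mul_sum]
    _ ≤ N * ∑' a, F a :=
        mul_le_mul_of_nonneg_left (hs.sum_le_tsum _ fun a _ => hF a) (Nat.cast_nonneg N)

theorem summable_comp_of_encard_fiber_le {α β : Type*} {φ : β → α} {N : ℕ}
    (hφ : ∀ a, {b | φ b = a}.encard ≤ N) {F : α → ℝ} (hF : ∀ a, 0 ≤ F a) (hs : Summable F) :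
    Summable fun b => F (φ b) :=
  summable_of_sum_le (fun b => hF (φ b)) (sum_comp_le_of_encard_fiber_le hφ hF hs)

theorem tsum_comp_le_of_encard_fiber_le {α β : Type*} {φ : β → α} {N : ℕ}
    (hφ : ∀ a, {b | φ b = a}.encard ≤ N) {F : α → ℝ} (hF : ∀ a, 0 ≤ F a) (hs : Summable F) :
    ∑' b, F (φ b) ≤ N * ∑' a, F a :=
  (summable_comp_of_encard_fiber_le hφ hF hs).tsum_le_of_sum_le
    (sum_comp_le_of_encard_fiber_le hφ hF hs)

theorem Memℓp.comp_of_encard_fiber_le {α β E : Type*} [NormedAddCommGroup E] {p : ℝ≥0∞}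
    (hp : 0 < p.toReal) {φ : β → α} {N : ℕ} (hφ : ∀ a, {b | φ b = a}.encard ≤ N) {f : α → E}
    (hf : Memℓp f p) : Memℓp (fun b => f (φ b)) p :=
  memℓp_gen <| summable_comp_of_encard_fiber_le (F := fun a => ‖f a‖ ^ p.toReal) hφ
    (fun _ => by positivity) (hf.summable hp)

/-! ### Valency and balls -/

theorem SimpleGraph.encard_dart_fst_eq {V : Type*} (G : SimpleGraph V) (x : V) :
    {d : G.Dart | d.fst = x}.encard ≤ (G.neighborSet x).encard := by
  refine Set.encard_le_encard_of_injOn (f := fun d : G.Dart => d.snd) ?_ ?_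
  · rintro d rfl
    exact d.adj
  · rintro d hd e he h
    exact SimpleGraph.Dart.ext _ _ (Prod.ext (hd.trans he.symm) h)

theorem SimpleGraph.encard_dart_snd_eq {V : Type*} (G : SimpleGraph V) (x : V) :
    {d : G.Dart | d.snd = x}.encard ≤ (G.neighborSet x).encard := by
  refine Set.encard_le_encard_of_injOn (f := fun d : G.Dart => d.fst) ?_ ?_
  · rintro d rfl
    exact d.adj.symm
  · rintro d hd e he h
    exact SimpleGraph.Dart.ext _ _ (Prod.ext h (hd.trans he.symm))

theorem BoundedValency.mono {V : Type*} {H G : SimpleGraph V} (hHG : H ≤ G)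
    (hG : BoundedValency G) : BoundedValency H := by
  obtain ⟨D, hD⟩ := hG
  exact ⟨D, fun x => (Set.encard_le_encard fun _ h => hHG h).trans (hD x)⟩

/-- Balls of a fixed radius in a graph of bounded valency have boundedly many vertices. -/
theorem BoundedValency.exists_card_ball_le {V : Type*} {G : SimpleGraph V}
    (hG : BoundedValency G) (n : ℕ) :
    ∃ B : ℕ, ∀ x : V, ∃ s : Finset V, s.card ≤ B ∧
      ∀ (y : V) (w : G.Walk x y), w.length ≤ n → y ∈ s := by
  classical
  obtain ⟨D, hD⟩ := hG
  induction n with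
  | zero =>
    refine ⟨1, fun x => ⟨{x}, by simp, fun y w hw => ?_⟩⟩
    rw [Finset.mem_singleton]
    exact (SimpleGraph.Walk.eq_of_length_eq_zero (Nat.le_zero.1 hw)).symm
  | succ n ih =>
    obtain ⟨B, hB⟩ := ih
    choose s hs hmem using hB
    refine ⟨D * B + 1, fun x => ?_⟩
    have hfin : (G.neighborSet x).Finite := Set.finite_of_encard_le_coe (hD x)
    refine ⟨insert x (hfin.toFinset.biUnion s), ?_, fun y w hw => ?_⟩
    · refine (Finset.card_insert_le _ _).trans (Nat.succ_le_succ ?_)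
      refine (Finset.card_biUnion_le_card_mul _ _ B fun z _ => hs z).trans ?_
      refine Nat.mul_le_mul_right B ?_
      have h := hD x
      rw [hfin.encard_eq_coe_toFinset_card] at h
      exact_mod_cast h
    · cases w with
      | nil => exact Finset.mem_insert_self _ _
      | cons h q =>
        refine Finset.mem_insert_of_mem (Finset.mem_biUnion.2 ⟨_, ?_, hmem _ _ q ?_⟩)
        · simpa using h
        · simpa using hw

theorem exists_walk_of_fuzz_adj {V : Type*} {Γ : SimpleGraph V} {n : ℕ} {x y : V}
    (h : (fuzz Γ n).Adj x y) : ∃ w : Γ.Walk x y, w.length ≤ n := by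
  have htop : Γ.edist x y ≠ ⊤ := (lt_of_le_of_lt h.2 (ENat.natCast_lt_top n)).ne
  obtain ⟨w, hw⟩ := SimpleGraph.exists_walk_of_edist_ne_top htop
  refine ⟨w, ?_⟩
  have := h.2
  rw [← hw] at this
  exact_mod_cast this

theorem BoundedValency.fuzz {V : Type*} {Γ : SimpleGraph V} (hΓ : BoundedValency Γ) (n : ℕ) :
    BoundedValency (fuzz Γ n) := by
  obtain ⟨B, hB⟩ := hΓ.exists_card_ball_le n
  refine ⟨B, fun x => ?_⟩
  obtain ⟨s, hs, hmem⟩ := hB x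
  have hsub : (_root_.fuzz Γ n).neighborSet x ⊆ (s : Set V) := fun y hy => by
    obtain ⟨w, hw⟩ := exists_walk_of_fuzz_adj hy
    exact hmem y w hw
  refine (Set.encard_le_encard hsub).trans ?_
  rw [Set.encard_coe_eq_coe_finsetCard]
  exact_mod_cast hs

theorem le_fuzz {V : Type*} (Γ : SimpleGraph V) {n : ℕ} (hn : 1 ≤ n) : Γ ≤ fuzz Γ n := by
  intro x y h
  refine ⟨h.ne, ?_⟩
  rw [SimpleGraph.edist_eq_one_iff_adj.2 h]
  exact_mod_cast hn

/-! ### Dirichlet functions of a graph and of its fuzz -/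

theorem Dirichlet.antitone {V : Type*} (𝕜 : Type*) [RCLike 𝕜] {H G : SimpleGraph V} (hHG : H ≤ G)
    {p : ℝ≥0∞} (hp : 0 < p.toReal) : Dirichlet 𝕜 G p ≤ Dirichlet 𝕜 H p := by
  intro g hg
  refine Memℓp.comp_of_encard_fiber_le (N := 1) hp
    (φ := fun d : H.Dart => (⟨d.toProd, hHG d.adj⟩ : G.Dart)) (fun a => ?_)
    (f := grad 𝕜 G g) hg
  refine Set.encard_le_one_iff.2 fun d e hd he => ?_
  have h := congrArg SimpleGraph.Dart.toProd
    (Eq.trans hd (Eq.symm he) : (⟨_, _⟩ : G.Dart) = ⟨_, _⟩)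
  exact SimpleGraph.Dart.ext _ _ h

theorem memℓp_grad {V : Type*} {𝕜 : Type*} [RCLike 𝕜] {G : SimpleGraph V}
    (hG : BoundedValency G) {p : ℝ≥0∞} (hp : 0 < p.toReal) {g : V → 𝕜} (hg : Memℓp g p) :
    Memℓp (grad 𝕜 G g) p := by
  obtain ⟨D, hD⟩ := hG
  exact (hg.comp_of_encard_fiber_le hp fun x => (G.encard_dart_snd_eq x).trans (hD x)).sub
    (hg.comp_of_encard_fiber_le hp fun x => (G.encard_dart_fst_eq x).trans (hD x))

/-- A function with `p`-summable gradient on `Γ` has `p`-summable gradient on the fuzz: the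
difference along an edge of the fuzz is a sum of at most `n` differences along a walk in `Γ`, and
only boundedly many of the chosen walks pass through a given vertex. -/
theorem dirichlet_le_dirichlet_fuzz {V : Type*} (𝕜 : Type*) [RCLike 𝕜] {Γ : SimpleGraph V}
    (hΓ : BoundedValency Γ) (n : ℕ) {p : ℝ≥0∞} (hp : 0 < p.toReal) :
    Dirichlet 𝕜 Γ p ≤ Dirichlet 𝕜 (fuzz Γ n) p := by
  classical
  intro g hg
  obtain ⟨B, hB⟩ := hΓ.exists_card_ball_le n
  choose s hs hmem using hB
  choose w hw using fun d : (fuzz Γ n).Dart => exists_walk_of_fuzz_adj d.adj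
  -- The gradient, extended by zero to all pairs of vertices; on the constant tail
  -- of a walk, beyond its length, it vanishes.
  let F : V × V → 𝕜 := fun e => if Γ.Adj e.1 e.2 then g e.2 - g e.1 else 0
  have hF : Memℓp F p := by
    refine memℓp_gen ?_
    have hinj : Function.Injective (SimpleGraph.Dart.toProd : Γ.Dart → V × V) :=
      fun d e h => SimpleGraph.Dart.ext _ _ h
    refine (hinj.summable_iff fun e he => ?_).1 ?_
    · have hadj : ¬ Γ.Adj e.1 e.2 := fun h => he ⟨⟨e, h⟩, rfl⟩
      simp [F, hadj, hp.ne']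
    · refine (Memℓp.summable hp hg).congr fun d => ?_
      simp [F, grad, d.adj]
  have hstep : ∀ i, Memℓp
      (fun d : (fuzz Γ n).Dart => F ((w d).getVert i, (w d).getVert (i + 1))) p := by
    intro i
    refine hF.comp_of_encard_fiber_le (N := B * B) hp
      (φ := fun d : (fuzz Γ n).Dart => ((w d).getVert i, (w d).getVert (i + 1))) fun a => ?_
    calc {d | ((w d).getVert i, (w d).getVert (i + 1)) = a}.encard
        ≤ ((s a.1 ×ˢ s a.1 : Finset (V × V)) : Set (V × V)).encard := by
          refine Set.encard_le_encard_of_injOn (f := SimpleGraph.Dart.toProd) ?_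
            fun d _ e _ h => SimpleGraph.Dart.ext _ _ h
          rintro d rfl
          refine Finset.mem_coe.2 (Finset.mem_product.2
            ⟨hmem _ _ ((w d).take i).reverse ?_, hmem _ _ ((w d).drop i) ?_⟩)
          · rw [SimpleGraph.Walk.length_reverse, SimpleGraph.Walk.take_length]
            exact (min_le_right _ _).trans (hw d)
          · rw [SimpleGraph.Walk.drop_length]
            exact (Nat.sub_le _ _).trans (hw d)
      _ ≤ (B * B : ℕ) := by
          rw [Set.encard_coe_eq_coe_finsetCard, Finset.card_product]
          exact_mod_cast Nat.mul_le_mul (hs _) (hs _)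
  have hsum : grad 𝕜 (fuzz Γ n) g = fun d =>
      ∑ i ∈ Finset.range n, F ((w d).getVert i, (w d).getVert (i + 1)) := by
    funext d
    have hterm : ∀ i, F ((w d).getVert i, (w d).getVert (i + 1)) =
        g ((w d).getVert (i + 1)) - g ((w d).getVert i) := by
      intro i
      rcases lt_or_ge i (w d).length with hi | hi
      · simp [F, (w d).adj_getVert_succ hi]
      · simp [F, (w d).getVert_of_length_le hi, (w d).getVert_of_length_le (hi.trans i.le_succ)]
    simp only [hterm]
    rw [Finset.sum_range_sub (fun i => g ((w d).getVert i)) n,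
      (w d).getVert_of_length_le (hw d), (w d).getVert_zero]
    rfl
  change Memℓp (grad 𝕜 (fuzz Γ n) g) p
  rw [hsum]
  exact Memℓp.finsetSum (Finset.range n) fun i _ => hstep i

/-! ### Cohomology classes as cosets -/

/-- The space `ℓ^p(V) + 𝕜` of the functions that are `p`-summable up to an additive constant. -/
def lpPlusConst (V : Type*) (𝕜 : Type*) [RCLike 𝕜] (p : ℝ≥0∞) : Submodule 𝕜 (V → 𝕜) where
  carrier := {g | ∃ c : 𝕜, Memℓp (fun x => g x - c) p}
  zero_mem' := ⟨0, by simpa using (zero_mem_ℓp' : Memℓp (fun _ : V => (0 : 𝕜)) p)⟩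
  add_mem' := by
    rintro g h ⟨c, hc⟩ ⟨d, hd⟩
    refine ⟨c + d, ?_⟩
    convert hc.add hd using 1
    funext x
    simp only [Pi.add_apply]
    ring
  smul_mem' := by
    rintro a g ⟨c, hc⟩
    refine ⟨a * c, ?_⟩
    convert hc.const_smul a using 1
    funext x
    simp only [Pi.smul_apply, smul_eq_mul]
    ring

theorem lpPlusConst_le_dirichlet {V : Type*} (𝕜 : Type*) [RCLike 𝕜] {G : SimpleGraph V}
    (hG : BoundedValency G) {p : ℝ≥0∞} (hp : 0 < p.toReal) :
    lpPlusConst V 𝕜 p ≤ Dirichlet 𝕜 G p := by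
  rintro g ⟨c, hc⟩
  have h : grad 𝕜 G g = grad 𝕜 G fun x => g x - c := by
    funext d
    simp [grad]
  change Memℓp (grad 𝕜 G g) p
  rw [h]
  exact memℓp_grad hG hp hc

theorem eq_of_grad_eq_zero {V : Type*} {𝕜 : Type*} [RCLike 𝕜] {G : SimpleGraph V}
    (hG : G.Connected) {g : V → 𝕜} (hg : grad 𝕜 G g = 0) (x y : V) : g x = g y := by
  obtain ⟨w⟩ := hG.preconnected x y
  induction w with
  | nil => rfl
  | cons h _ ih => exact (sub_eq_zero.1 (congrFun hg ⟨(_, _), h⟩)).symm.trans ih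

theorem lpClass_zero {V : Type*} (𝕜 : Type*) [RCLike 𝕜] (G : SimpleGraph V) (p : ℝ≥0∞) :
    lpClass 𝕜 G p 0 = 0 :=
  (Submodule.Quotient.mk_eq_zero _).2 ⟨0, zero_memℓp, rfl⟩

theorem lpClass_surjective {V : Type*} (𝕜 : Type*) [RCLike 𝕜] (G : SimpleGraph V) (p : ℝ≥0∞) :
    Function.Surjective (lpClass 𝕜 G p) := by
  intro c
  obtain ⟨⟨f, g, hg⟩, rfl⟩ := Submodule.Quotient.mk_surjective _ c
  have hmem : g ∈ Dirichlet 𝕜 G p := by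
    change Memℓp (grad 𝕜 G g) p
    rw [hg]
    exact lp.memℓp f
  exact ⟨⟨g, hmem⟩, congrArg Submodule.Quotient.mk (Subtype.ext (lp.ext hg))⟩

theorem lpClass_eq_iff {V : Type*} {𝕜 : Type*} [RCLike 𝕜] {G : SimpleGraph V}
    (hG : G.Connected) {p : ℝ≥0∞} (g h : Dirichlet 𝕜 G p) :
    lpClass 𝕜 G p g = lpClass 𝕜 G p h ↔ (g : V → 𝕜) - h ∈ lpPlusConst V 𝕜 p := by
  rw [lpClass, lpClass, Submodule.Quotient.eq]
  constructor
  · rintro ⟨u, hu, hgrad⟩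
    have h0 : grad 𝕜 G ((g : V → 𝕜) - h - u) = 0 := by
      rw [map_sub, map_sub, hgrad]
      exact sub_self _
    obtain ⟨o⟩ := hG.nonempty
    refine ⟨((g : V → 𝕜) - h - u) o, ?_⟩
    convert hu using 1
    funext x
    rw [eq_of_grad_eq_zero hG h0 o x]
    simp
  · rintro ⟨c, hc⟩
    refine ⟨_, hc, ?_⟩
    funext d
    change _ = grad 𝕜 G g.1 d - grad 𝕜 G h.1 d
    simp only [grad, LinearMap.coe_mk, AddHom.coe_mk, Pi.sub_apply]
    ring

/-- The non-trivial classes of a connected graph are the cosets `g + (ℓ^p(V) + 𝕜)` with `g` a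
Dirichlet function. The graph enters this description only through its space of Dirichlet
functions. -/
theorem mem_nontrivialClasses_iff {V : Type*} {𝕜 : Type*} [RCLike 𝕜] {G : SimpleGraph V}
    (hG : G.Connected) (hval : BoundedValency G) {p : ℝ≥0∞} (hp : 0 < p.toReal)
    {C : Set (V → 𝕜)} :
    C ∈ nontrivialClasses 𝕜 G p ↔ ∃ g ∈ Dirichlet 𝕜 G p, g ∉ lpPlusConst V 𝕜 p ∧
      C = {h | h - g ∈ lpPlusConst V 𝕜 p} := by
  have hzero : ∀ g : Dirichlet 𝕜 G p,
      lpClass 𝕜 G p g = 0 ↔ (g : V → 𝕜) ∈ lpPlusConst V 𝕜 p := by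
    intro g
    have h := lpClass_eq_iff hG g 0
    rw [lpClass_zero, ZeroMemClass.coe_zero, sub_zero] at h
    exact h
  have hset : ∀ g : Dirichlet 𝕜 G p,
      {h | ∃ hh : h ∈ Dirichlet 𝕜 G p, lpClass 𝕜 G p ⟨h, hh⟩ = lpClass 𝕜 G p g} =
        {h | h - (g : V → 𝕜) ∈ lpPlusConst V 𝕜 p} := by
    intro g
    ext h
    rw [Set.mem_ofPred_eq, Set.mem_ofPred_eq]
    refine ⟨fun H => (lpClass_eq_iff hG ⟨h, H.1⟩ g).1 H.2, fun e => ?_⟩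
    have hh : h ∈ Dirichlet 𝕜 G p := by
      simpa using add_mem (lpPlusConst_le_dirichlet 𝕜 hval hp e) g.2
    exact ⟨hh, (lpClass_eq_iff hG ⟨h, hh⟩ g).2 e⟩
  constructor
  · rintro ⟨c, hc, rfl⟩
    obtain ⟨g, rfl⟩ := lpClass_surjective 𝕜 G p c
    exact ⟨g, g.2, fun h => hc ((hzero g).2 h), hset g⟩
  · rintro ⟨g, hg, hne, rfl⟩
    exact ⟨lpClass 𝕜 G p ⟨g, hg⟩, fun h => hne ((hzero ⟨g, hg⟩).1 h), (hset ⟨g, hg⟩).symm⟩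

/-- Passing to a connected spanning subgraph `H` of `G` loses no cohomology class: the classes of
`G` are the classes of `H` all of whose representatives are Dirichlet functions on `G`. -/
theorem nontrivialClasses_eq_of_le {V : Type*} (𝕜 : Type*) [RCLike 𝕜] {H G : SimpleGraph V}
    (hHG : H ≤ G) (hH : H.Connected) (hval : BoundedValency G) {p : ℝ≥0∞} (hp : 0 < p.toReal) :
    nontrivialClasses 𝕜 G p =
      {C ∈ nontrivialClasses 𝕜 H p | C ⊆ (Dirichlet 𝕜 G p : Set (V → 𝕜))} := by
  ext C
  rw [Set.mem_sep_iff, mem_nontrivialClasses_iff (hH.mono hHG) hval hp,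
    mem_nontrivialClasses_iff hH (hval.mono hHG) hp]
  constructor
  · rintro ⟨g, hg, hne, rfl⟩
    refine ⟨⟨g, Dirichlet.antitone 𝕜 hHG hp hg, hne, rfl⟩, fun h hh => ?_⟩
    have := add_mem (lpPlusConst_le_dirichlet 𝕜 hval hp hh) hg
    rwa [sub_add_cancel] at this
  · rintro ⟨⟨g, _, hne, rfl⟩, hsub⟩
    have hgg : g - g ∈ lpPlusConst V 𝕜 p := by
      rw [sub_self]
      exact zero_mem _
    exact ⟨g, hsub hgg, hne, rfl⟩

theorem nontrivialClasses_fuzz {V : Type*} (𝕜 : Type*) [RCLike 𝕜] {Γ : SimpleGraph V}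
    (hconn : Γ.Connected) (hval : BoundedValency Γ) {n : ℕ} (hn : 1 ≤ n) {p : ℝ≥0∞}
    (hp : 0 < p.toReal) :
    nontrivialClasses 𝕜 (fuzz Γ n) p = nontrivialClasses 𝕜 Γ p := by
  have hD : Dirichlet 𝕜 (fuzz Γ n) p = Dirichlet 𝕜 Γ p :=
    le_antisymm (Dirichlet.antitone 𝕜 (le_fuzz Γ hn) hp) (dirichlet_le_dirichlet_fuzz 𝕜 hval n hp)
  ext C
  rw [mem_nontrivialClasses_iff (hconn.mono (le_fuzz Γ hn)) (hval.fuzz n) hp,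
    mem_nontrivialClasses_iff hconn hval hp, hD]

/-! ### The co-area inequality -/

theorem StrongIsoperimetric.mul_card_le_tsum {V : Type*} {Γ : SimpleGraph V} {κ : ℝ}
    (hκ : StrongIsoperimetric Γ κ) {A : Finset V} (hA : A.Nonempty) :
    ENNReal.ofReal κ * A.card ≤
      ∑' d : Γ.Dart, {d : Γ.Dart | d.fst ∈ A ∧ d.snd ∉ A}.indicator (fun _ => (1 : ℝ≥0∞)) d := by
  set S := {d : Γ.Dart | d.fst ∈ A ∧ d.snd ∉ A} with hS
  have himage : edgeBoundary Γ (A : Set V) = SimpleGraph.Dart.toProd '' S := by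
    ext e
    constructor
    · rintro ⟨h₁, h₂, h⟩
      exact ⟨⟨e, h⟩, ⟨h₁, h₂⟩, rfl⟩
    · rintro ⟨d, ⟨h₁, h₂⟩, rfl⟩
      exact ⟨h₁, h₂, d.adj⟩
  -- `ncard` is `0` on infinite sets, which is harmless in an upper bound.
  have hcard : ((edgeBoundary Γ (A : Set V)).ncard : ℕ∞) ≤ S.encard := by
    refine (ENat.natCast_toNat_le_self _).trans ?_
    rw [himage]
    exact Set.encard_image_le _ _
  rw [← tsum_subtype S (fun _ => (1 : ℝ≥0∞)), ENNReal.tsum_set_one]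
  calc ENNReal.ofReal κ * A.card = ENNReal.ofReal (κ * A.card) := by
        rw [ENNReal.ofReal_mul hκ.1.le, ENNReal.ofReal_natCast]
    _ ≤ ENNReal.ofReal ((edgeBoundary Γ (A : Set V)).ncard : ℝ) :=
        ENNReal.ofReal_le_ofReal (hκ.2 A hA)
    _ = (((edgeBoundary Γ (A : Set V)).ncard : ℕ∞) : ℝ≥0∞) := by
        rw [ENNReal.ofReal_natCast]
        rfl
    _ ≤ S.encard := by exact_mod_cast hcard

/-- The co-area inequality for finitely supported functions. A function `f` with support in `A`
and minimum `m` on `A` is `m` times the indicator of `A` plus a non-negative function whose support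
is smaller; both sides are additive in this decomposition. -/
theorem StrongIsoperimetric.mul_sum_le_tsum {V : Type*} {Γ : SimpleGraph V} {κ : ℝ}
    (hκ : StrongIsoperimetric Γ κ) (A : Finset V) :
    ∀ f : V → ℝ, (∀ x, 0 ≤ f x) → (∀ x ∉ A, f x = 0) →
      ENNReal.ofReal κ * ∑ x ∈ A, ENNReal.ofReal (f x) ≤
        ∑' d : Γ.Dart, ENNReal.ofReal (f d.fst - f d.snd) := by
  classical
  induction A using Finset.strongInduction with
  | H A ih =>
    intro f hf hfA
    rcases A.eq_empty_or_nonempty with rfl | hA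
    · simp
    obtain ⟨x₀, hx₀, hmin⟩ := A.exists_min_image f hA
    set m := f x₀ with hm
    have hm0 : 0 ≤ m := hf x₀
    let f' : V → ℝ := fun x => if x ∈ A then f x - m else 0
    have hf' : ∀ x, 0 ≤ f' x := by
      intro x
      by_cases hx : x ∈ A
      · simpa [f', hx] using hmin x hx
      · simp [f', hx]
    have hfA' : ∀ x ∉ A.erase x₀, f' x = 0 := by
      intro x hx
      by_cases hxA : x ∈ A
      · have : x = x₀ := by
          by_contra hne
          exact hx (Finset.mem_erase.2 ⟨hne, hxA⟩)
        simp [f', this, hm]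
      · simp [f', hxA]
    have hsum : ∑ x ∈ A, ENNReal.ofReal (f x) =
        ∑ x ∈ A.erase x₀, ENNReal.ofReal (f' x) + A.card * ENNReal.ofReal m := by
      have h₁ : ∑ x ∈ A.erase x₀, ENNReal.ofReal (f' x) = ∑ x ∈ A, ENNReal.ofReal (f' x) :=
        Finset.sum_subset (A.erase_subset x₀) fun x _ hx => by rw [hfA' x hx, ENNReal.ofReal_zero]
      rw [h₁, ← nsmul_eq_mul, ← Finset.sum_const, ← Finset.sum_add_distrib]
      refine Finset.sum_congr rfl fun x hx => ?_
      rw [← ENNReal.ofReal_add (hf' x) hm0]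
      simp [f', hx]
    have hdart : ∀ d : Γ.Dart, ENNReal.ofReal (f d.fst - f d.snd) =
        ENNReal.ofReal (f' d.fst - f' d.snd) + ENNReal.ofReal m *
          {d : Γ.Dart | d.fst ∈ A ∧ d.snd ∉ A}.indicator (fun _ => (1 : ℝ≥0∞)) d := by
      intro d
      by_cases h₁ : d.fst ∈ A
      · by_cases h₂ : d.snd ∈ A
        · simp [f', h₁, h₂]
        · have h := hmin _ h₁
          simp only [f', h₁, h₂, hfA _ h₂, Set.indicator, Set.mem_ofPred_eq, if_true, if_false,
            not_false_iff, and_self, mul_one, sub_zero]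
          rw [← ENNReal.ofReal_add (sub_nonneg.2 h) hm0, sub_add_cancel]
      · have e₁ : f d.fst - f d.snd ≤ 0 := by
          rw [hfA _ h₁]
          linarith [hf d.snd]
        have e₂ : f' d.fst - f' d.snd ≤ 0 := by
          have : f' d.fst = 0 := by simp [f', h₁]
          linarith [hf' d.snd]
        simp [h₁, ENNReal.ofReal_of_nonpos e₁, ENNReal.ofReal_of_nonpos e₂]
    simp only [hdart]
    rw [ENNReal.tsum_add, ENNReal.tsum_mul_left, hsum, mul_add]
    refine add_le_add (ih _ (Finset.erase_ssubset hx₀) f' hf' hfA') ?_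
    calc ENNReal.ofReal κ * (A.card * ENNReal.ofReal m)
        = ENNReal.ofReal m * (ENNReal.ofReal κ * A.card) := by ring
      _ ≤ _ := mul_le_mul_right (hκ.mul_card_le_tsum hA) _

/-- The co-area inequality for summable functions, by truncation: `(f - ε)⁺` has finite support,
its positive increments are at most those of `f`, and it increases to `f⁺` as `ε` tends to `0`. -/
theorem StrongIsoperimetric.mul_tsum_le_tsum {V : Type*} {Γ : SimpleGraph V} {κ : ℝ}
    (hκ : StrongIsoperimetric Γ κ) {f : V → ℝ} (hs : Summable f) :
    ENNReal.ofReal κ * ∑' x, ENNReal.ofReal (f x) ≤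
      ∑' d : Γ.Dart, ENNReal.ofReal (f d.fst - f d.snd) := by
  classical
  rw [← ENNReal.tsum_mul_left, ENNReal.tsum_eq_iSup_sum]
  refine iSup_le fun s => ?_
  rw [← Finset.mul_sum]
  have htrunc : ∀ ε : ℝ, 0 < ε → ENNReal.ofReal κ * ∑ x ∈ s, ENNReal.ofReal (f x - ε) ≤
      ∑' d : Γ.Dart, ENNReal.ofReal (f d.fst - f d.snd) := by
    intro ε hε
    have hfin : {x | ¬ f x < ε}.Finite :=
      Filter.eventually_cofinite.1 (hs.tendsto_cofinite_zero.eventually_lt_const hε)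
    have h := hκ.mul_sum_le_tsum (s ∪ hfin.toFinset) (fun x => max (f x - ε) 0)
      (fun x => le_max_right _ _) (fun x hx => by
        have hx' : f x < ε := by
          by_contra hlt
          exact hx (Finset.mem_union_right _ (hfin.mem_toFinset.2 hlt))
        exact max_eq_right (by linarith))
    refine le_trans (mul_le_mul_right ?_ _) (h.trans (ENNReal.tsum_le_tsum fun d => ?_))
    · refine le_trans (Finset.sum_le_sum fun x _ => ?_)
        (Finset.sum_le_sum_of_subset Finset.subset_union_left)
      exact ENNReal.ofReal_le_ofReal (le_max_left _ _)
    · rcases le_total (f d.fst - ε) 0 with h₁ | h₁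
      · refine (ENNReal.ofReal_of_nonpos ?_).trans_le zero_le
        rw [max_eq_right h₁, zero_sub]
        exact neg_nonpos.2 (le_max_right _ _)
      · refine ENNReal.ofReal_le_ofReal ?_
        rw [max_eq_left h₁]
        linarith [le_max_left (f d.snd - ε) 0]
  have hlim : Filter.Tendsto (fun ε : ℝ => ENNReal.ofReal κ * ∑ x ∈ s, ENNReal.ofReal (f x - ε))
      (nhdsWithin 0 (Set.Ioi 0))
      (nhds (ENNReal.ofReal κ * ∑ x ∈ s, ENNReal.ofReal (f x))) := by
    refine ENNReal.Tendsto.const_mul (tendsto_finsetSum s fun x _ => ?_)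
      (Or.inr ENNReal.ofReal_ne_top)
    refine ENNReal.tendsto_ofReal ?_
    have hc : Continuous fun ε : ℝ => f x - ε := by fun_prop
    have := hc.tendsto 0
    rw [sub_zero] at this
    exact this.mono_left nhdsWithin_le_nhds
  exact le_of_tendsto hlim (eventually_nhdsWithin_of_forall htrunc)

/-! ### The Sobolev inequality -/

/-- A form of Young's inequality; it follows from the convexity of `t ↦ t ^ p` applied to
`‖b‖ + ‖b - a‖ = (1 - t) (‖b‖ / (1 - t)) + t (‖b - a‖ / t)` with `t` close to `0`. -/
theorem exists_norm_rpow_sub_le {p : ℝ} (hp : 1 ≤ p) {δ : ℝ} (hδ : 0 < δ) :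
    ∃ C : ℝ, 0 ≤ C ∧ ∀ {E : Type*} [SeminormedAddCommGroup E] (a b : E),
      ‖a‖ ^ p - ‖b‖ ^ p ≤ δ * ‖b‖ ^ p + C * ‖b - a‖ ^ p := by
  obtain ⟨t, ht0, ht1, ht⟩ : ∃ t : ℝ, 0 < t ∧ t < 1 ∧ (1 - t) * (1 - t)⁻¹ ^ p < 1 + δ := by
    have hc : ContinuousAt (fun t : ℝ => (1 - t) * (1 - t)⁻¹ ^ p) 0 := by
      have h1 : ContinuousAt (fun t : ℝ => 1 - t) 0 := by fun_prop
      refine h1.mul ((h1.inv₀ (by norm_num)).rpow_const (Or.inl (by norm_num)))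
    have hev : ∀ᶠ t in nhdsWithin (0 : ℝ) (Set.Ioi 0), (1 - t) * (1 - t)⁻¹ ^ p < 1 + δ := by
      refine nhdsWithin_le_nhds (hc.eventually_lt_const ?_)
      simpa using hδ
    have hI : ∀ᶠ t in nhdsWithin (0 : ℝ) (Set.Ioi 0), t ∈ Set.Ioo (0 : ℝ) 1 :=
      Ioo_mem_nhdsGT one_pos
    obtain ⟨t, h1, h2⟩ := (hev.and hI).exists
    exact ⟨t, h2.1, h2.2, h1⟩
  have hs0 : 0 < 1 - t := sub_pos.2 ht1
  refine ⟨t * t⁻¹ ^ p, by positivity, fun {E} _ a b => ?_⟩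
  have htri : ‖a‖ ≤ ‖b‖ + ‖b - a‖ := by
    have := norm_sub_le b (b - a)
    rwa [sub_sub_cancel] at this
  have hconv := (convexOn_rpow hp).2 (x := (1 - t)⁻¹ * ‖b‖) (y := t⁻¹ * ‖b - a‖)
    (Set.mem_Ici.2 (by positivity)) (Set.mem_Ici.2 (by positivity)) hs0.le ht0.le
    (sub_add_cancel 1 t)
  simp only [smul_eq_mul] at hconv
  rw [mul_inv_cancel_left₀ hs0.ne', mul_inv_cancel_left₀ ht0.ne',
    Real.mul_rpow (inv_nonneg.2 hs0.le) (norm_nonneg _),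
    Real.mul_rpow (inv_nonneg.2 ht0.le) (norm_nonneg _), ← mul_assoc, ← mul_assoc] at hconv
  have hmono : ‖a‖ ^ p ≤ (‖b‖ + ‖b - a‖) ^ p :=
    Real.rpow_le_rpow (norm_nonneg _) htri (by linarith)
  have hb : 0 ≤ ‖b‖ ^ p := by positivity
  nlinarith [mul_le_mul_of_nonneg_right ht.le hb]

/-- The Sobolev inequality of a graph with a strong isoperimetric inequality: the co-area
inequality for `‖g‖ ^ p`, where Young's inequality bounds the increments of `‖g‖ ^ p` by those
of `g` at the cost of a small multiple of `‖g‖ ^ p`. -/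
theorem StrongIsoperimetric.exists_tsum_le_tsum_grad {V : Type*} (𝕜 : Type*) [RCLike 𝕜]
    {Γ : SimpleGraph V} {κ : ℝ} (hκ : StrongIsoperimetric Γ κ) (hval : BoundedValency Γ)
    {p : ℝ≥0∞} (hp : 1 ≤ p.toReal) :
    ∃ C : ℝ, 0 ≤ C ∧ ∀ g : V → 𝕜, Memℓp g p →
      ∑' x, ‖g x‖ ^ p.toReal ≤ C * ∑' d, ‖grad 𝕜 Γ g d‖ ^ p.toReal := by
  have hp0 : 0 < p.toReal := one_pos.trans_le hp
  have hκ0 := hκ.1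
  obtain ⟨D, hD⟩ := id hval
  -- With this `δ`, the error term summed over all edges is at most half of the left-hand side.
  set δ : ℝ := κ / (2 * (D + 1)) with hδ
  have hδ0 : 0 < δ := by positivity
  have hδD : δ * D ≤ κ / 2 := by
    rw [hδ, div_mul_eq_mul_div, div_le_div_iff₀ (by positivity) two_pos]
    nlinarith
  obtain ⟨C, hC0, hC⟩ := exists_norm_rpow_sub_le hp hδ0
  refine ⟨2 * C / κ, by positivity, fun g hg => ?_⟩
  set f : V → ℝ := fun x => ‖g x‖ ^ p.toReal with hf
  set G : Γ.Dart → ℝ := fun d => ‖grad 𝕜 Γ g d‖ ^ p.toReal with hG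
  have hf0 : ∀ x, 0 ≤ f x := fun x => by positivity
  have hG0 : ∀ d, 0 ≤ G d := fun d => by positivity
  have hfs : Summable f := hg.summable hp0
  have hGs : Summable G := (memℓp_grad hval hp0 hg).summable hp0
  have hfib : ∀ x, {d : Γ.Dart | d.snd = x}.encard ≤ D :=
    fun x => (Γ.encard_dart_snd_eq x).trans (hD x)
  have hsnd := summable_comp_of_encard_fiber_le hfib hf0 hfs
  have hsnd_le := tsum_comp_le_of_encard_fiber_le hfib hf0 hfs
  have hmain : κ * ∑' x, f x ≤ δ * ∑' d : Γ.Dart, f d.snd + C * ∑' d, G d := by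
    rw [← tsum_mul_left (a := δ), ← tsum_mul_left (a := C),
      ← (hsnd.mul_left δ).tsum_add (hGs.mul_left C)]
    have hR0 : ∀ d : Γ.Dart, 0 ≤ δ * f d.snd + C * G d :=
      fun d => add_nonneg (mul_nonneg hδ0.le (hf0 _)) (mul_nonneg hC0 (hG0 d))
    rw [← ENNReal.ofReal_le_ofReal_iff (tsum_nonneg hR0), ENNReal.ofReal_mul hκ0.le,
      ENNReal.ofReal_tsum_of_nonneg hf0 hfs,
      ENNReal.ofReal_tsum_of_nonneg hR0 ((hsnd.mul_left δ).add (hGs.mul_left C))]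
    exact (hκ.mul_tsum_le_tsum hfs).trans
      (ENNReal.tsum_le_tsum fun d => ENNReal.ofReal_le_ofReal (hC (g d.fst) (g d.snd)))
  have hS0 : 0 ≤ ∑' x, f x := tsum_nonneg hf0
  have hhalf : κ * ∑' x, f x ≤ κ / 2 * ∑' x, f x + C * ∑' d, G d := by
    refine hmain.trans (add_le_add_left ?_ _)
    calc δ * ∑' d : Γ.Dart, f d.snd ≤ δ * (D * ∑' x, f x) :=
          mul_le_mul_of_nonneg_left hsnd_le hδ0.le
      _ = δ * D * ∑' x, f x := by ring
      _ ≤ κ / 2 * ∑' x, f x := mul_le_mul_of_nonneg_right hδD hS0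
  rw [div_mul_eq_mul_div, le_div_iff₀ hκ0]
  linarith

/-! ### The gradient on `ℓ^p` has closed range -/

theorem exists_tsum_grad_le_tsum {V : Type*} (𝕜 : Type*) [RCLike 𝕜] {Γ : SimpleGraph V}
    (hval : BoundedValency Γ) {p : ℝ≥0∞} (hp : 1 ≤ p.toReal) :
    ∃ C : ℝ, 0 ≤ C ∧ ∀ g : V → 𝕜, Memℓp g p →
      ∑' d, ‖grad 𝕜 Γ g d‖ ^ p.toReal ≤ C * ∑' x, ‖g x‖ ^ p.toReal := by
  have hp0 : 0 < p.toReal := one_pos.trans_le hp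
  obtain ⟨D, hD⟩ := id hval
  obtain ⟨C, hC0, hC⟩ := exists_norm_rpow_sub_le hp one_pos
  refine ⟨2 * D + C * D, by positivity, fun g hg => ?_⟩
  set f : V → ℝ := fun x => ‖g x‖ ^ p.toReal with hf
  have hf0 : ∀ x, 0 ≤ f x := fun x => by positivity
  have hfs : Summable f := hg.summable hp0
  have hfst : ∀ x, {d : Γ.Dart | d.fst = x}.encard ≤ D :=
    fun x => (Γ.encard_dart_fst_eq x).trans (hD x)
  have hsnd : ∀ x, {d : Γ.Dart | d.snd = x}.encard ≤ D :=
    fun x => (Γ.encard_dart_snd_eq x).trans (hD x)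
  have hs₁ := summable_comp_of_encard_fiber_le hfst hf0 hfs
  have hs₂ := summable_comp_of_encard_fiber_le hsnd hf0 hfs
  have hpt : ∀ d : Γ.Dart, ‖grad 𝕜 Γ g d‖ ^ p.toReal ≤ 2 * f d.fst + C * f d.snd := by
    intro d
    have h := hC (g d.snd - g d.fst) (-g d.fst)
    have e : -g d.fst - (g d.snd - g d.fst) = -g d.snd := by ring
    rw [e, norm_neg, norm_neg] at h
    change ‖g d.snd - g d.fst‖ ^ p.toReal ≤ _
    linarith
  calc ∑' d, ‖grad 𝕜 Γ g d‖ ^ p.toReal ≤ ∑' d : Γ.Dart, (2 * f d.fst + C * f d.snd) :=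
        ((memℓp_grad hval hp0 hg).summable hp0).tsum_le_tsum hpt
          ((hs₁.mul_left 2).add (hs₂.mul_left C))
    _ = 2 * ∑' d : Γ.Dart, f d.fst + C * ∑' d : Γ.Dart, f d.snd := by
        rw [(hs₁.mul_left 2).tsum_add (hs₂.mul_left C), tsum_mul_left, tsum_mul_left]
    _ ≤ 2 * (D * ∑' x, f x) + C * (D * ∑' x, f x) :=
        add_le_add
          (mul_le_mul_of_nonneg_left (tsum_comp_le_of_encard_fiber_le hfst hf0 hfs) two_pos.le)
          (mul_le_mul_of_nonneg_left (tsum_comp_le_of_encard_fiber_le hsnd hf0 hfs) hC0)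
    _ = (2 * D + C * D) * ∑' x, f x := by ring

theorem lp.norm_le_mul_of_tsum_le {α β E F : Type*} [NormedAddCommGroup E] [NormedAddCommGroup F]
    {p : ℝ≥0∞} (hp : 0 < p.toReal) {C : ℝ} (hC : 0 ≤ C) {f : lp (fun _ : α => E) p}
    {h : lp (fun _ : β => F) p}
    (hfh : ∑' a, ‖f a‖ ^ p.toReal ≤ C * ∑' b, ‖h b‖ ^ p.toReal) :
    ‖f‖ ≤ C ^ (1 / p.toReal) * ‖h‖ := by
  refine lp.norm_le_of_tsum_le hp (mul_nonneg (by positivity) (lp.norm_nonneg' h)) ?_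
  rw [Real.mul_rpow (by positivity) (lp.norm_nonneg' h), ← Real.rpow_mul hC,
    one_div_mul_cancel hp.ne', Real.rpow_one, lp.norm_rpow_eq_tsum hp]
  exact hfh

/-- The gradient on a graph of bounded valency as a linear map from `ℓ^p(V)` to `ℓ^p(E)`. -/
def gradLp {V : Type*} (𝕜 : Type*) [RCLike 𝕜] {Γ : SimpleGraph V} (hval : BoundedValency Γ)
    {p : ℝ≥0∞} (hp : 0 < p.toReal) :
    lp (fun _ : V => 𝕜) p →ₗ[𝕜] lp (fun _ : Γ.Dart => 𝕜) p where
  toFun g := ⟨grad 𝕜 Γ g, memℓp_grad hval hp (lp.memℓp g)⟩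
  map_add' g h := Subtype.ext (map_add (grad 𝕜 Γ) (g : V → 𝕜) h)
  map_smul' c g := Subtype.ext (map_smul (grad 𝕜 Γ) c (g : V → 𝕜))

theorem StrongIsoperimetric.isClosed_gradientsOfLp {V : Type*} (𝕜 : Type*) [RCLike 𝕜]
    {Γ : SimpleGraph V} {κ : ℝ} (hκ : StrongIsoperimetric Γ κ) (hval : BoundedValency Γ)
    {p : ℝ≥0∞} [Fact (1 ≤ p)] (hp : 1 ≤ p.toReal) :
    IsClosed (gradientsOfLp 𝕜 Γ p : Set (lp (fun _ : Γ.Dart => 𝕜) p)) := by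
  have hp0 : 0 < p.toReal := one_pos.trans_le hp
  let L := gradLp 𝕜 hval hp0
  have hrange : (gradientsOfLp 𝕜 Γ p : Set (lp (fun _ : Γ.Dart => 𝕜) p)) = Set.range L := by
    ext f
    constructor
    · rintro ⟨g, hg, hf⟩
      exact ⟨⟨g, hg⟩, lp.ext hf⟩
    · rintro ⟨g, rfl⟩
      exact ⟨g, lp.memℓp g, rfl⟩
  obtain ⟨C₁, hC₁, h₁⟩ := exists_tsum_grad_le_tsum 𝕜 hval hp
  obtain ⟨C₂, hC₂, h₂⟩ := hκ.exists_tsum_le_tsum_grad 𝕜 hval hp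
  have hcont : UniformContinuous L :=
    (L.mkContinuous _ fun g => lp.norm_le_mul_of_tsum_le hp0 hC₁ (f := L g)
      (h₁ g (lp.memℓp g))).uniformContinuous
  have hanti : AntilipschitzWith (C₂ ^ (1 / p.toReal)).toNNReal L := by
    refine AddMonoidHomClass.antilipschitz_of_bound L fun g => ?_
    rw [Real.coe_toNNReal _ (by positivity)]
    exact lp.norm_le_mul_of_tsum_le hp0 hC₂ (h := L g) (h₂ g (lp.memℓp g))
  rw [hrange]
  exact hanti.isClosed_range hcont

theorem injective_toReducedLpH1_of_isClosed {V : Type*} {𝕜 : Type*} [RCLike 𝕜]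
    {Γ : SimpleGraph V} {p : ℝ≥0∞} [Fact (1 ≤ p)]
    (h : IsClosed (gradientsOfLp 𝕜 Γ p : Set (lp (fun _ : Γ.Dart => 𝕜) p))) :
    Function.Injective (toReducedLpH1 𝕜 Γ p) := by
  refine (injective_iff_map_eq_zero _).2 fun c hc => ?_
  obtain ⟨f, rfl⟩ := Submodule.Quotient.mk_surjective _ c
  have hf : f ∈ (gradientsOfLp 𝕜 Γ p).topologicalClosure.submoduleOf (lpGradients 𝕜 Γ p) :=
    (Submodule.Quotient.mk_eq_zero _).1 hc
  rw [h.submodule_topologicalClosure_eq] at hf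
  exact (Submodule.Quotient.mk_eq_zero _).2 hf

/-! ### Reducedness and the spanning tree -/

theorem mainTheorem2 {V : Type*} (𝕜 : Type*) [RCLike 𝕜] (Γ : SimpleGraph V)
    (hconn : Γ.Connected) (hval : BoundedValency Γ)
    (κ : ℝ) (hκ : StrongIsoperimetric Γ κ) :
    (∀ (p : ℝ≥0∞) [Fact (1 ≤ p)], p ≠ ∞ → Function.Injective (toReducedLpH1 𝕜 Γ p)) ∧
    ∃ T : SimpleGraph V, T ≤ fuzz Γ ⌈κ⁻¹⌉₊ ∧ T.IsTree ∧
      ∀ p : ℝ≥0∞, 1 ≤ p → p ≠ ∞ →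
        nontrivialClasses 𝕜 Γ p =
          {C ∈ nontrivialClasses 𝕜 T p |
            C ⊆ (Dirichlet 𝕜 (fuzz Γ ⌈κ⁻¹⌉₊) p : Set (V → 𝕜))} ∧
        nontrivialClasses 𝕜 (fuzz Γ ⌈κ⁻¹⌉₊) p =
          {C ∈ nontrivialClasses 𝕜 T p |
            C ⊆ (Dirichlet 𝕜 (fuzz Γ ⌈κ⁻¹⌉₊) p : Set (V → 𝕜))} := by
  have hp1 : ∀ p : ℝ≥0∞, 1 ≤ p → p ≠ ∞ → 1 ≤ p.toReal := fun p h h' => by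
    simpa using ENNReal.toReal_mono h' h
  refine ⟨fun p hp hptop => injective_toReducedLpH1_of_isClosed
    (hκ.isClosed_gradientsOfLp 𝕜 hval (hp1 p hp.out hptop)), ?_⟩
  have hn : 1 ≤ ⌈κ⁻¹⌉₊ := Nat.ceil_pos.2 (inv_pos.2 hκ.1)
  obtain ⟨T, hle, hT⟩ := (hconn.mono (le_fuzz Γ hn)).exists_isTree_le
  refine ⟨T, hle, hT, fun p h h' => ?_⟩
  have hp0 : 0 < p.toReal := one_pos.trans_le (hp1 p h h')
  have hfuzz := nontrivialClasses_eq_of_le 𝕜 hle hT.connected (hval.fuzz _) hp0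
  exact ⟨(nontrivialClasses_fuzz 𝕜 hconn hval hn hp0).symm.trans hfuzz, hfuzz⟩
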